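/- Let $n,q\ge 1$. Identify $\mathbb C^n$ with $\mathbb R^{2n}$, with Euclidean norm and Lebesgue measure. Let $H\subset\mathbb R^{2n}=\mathbb C^n$ be a (nonempty) real affine subspace of real codimension $m\ge 3$, and put $d_H(z)=\inf_{w\in H}|z-w|$. A $(0,q)$-form is written $v=\sum'_{|J|=q}v_J\,d\bar z_J$, the sum being over strictly increasing multi-indices $J=(j_1<\dots<j_q)$ in $\{1,\dots,n\}$, with measurable coefficients $v_J:\mathbb C^n\to\mathbb C$ and $|v|^2=\sum'_J|v_J|^2$; the operator $\bar\partial v=\sum'_J\sum_{j=1}^n\frac{\partial v_J}{\partial\bar z_j}\,d\bar z_j\wedge d\bar z_J$ is understood in the sense of distributions. Then for every $(0,q)$-form $v$ on $\mathbb C^n$ with $\bar\partial v=0$, $\int_{\mathbb C^n}|v|^2<\infty$ and $\int_{\mathbb C^n}|v|^2d_H^2<\infty$, there exists a square-integrable $(0,q-1)$-form $u$ on $\mathbb C^n$ such that $\bar\partial u=v$ and $$\int_{\mathbb C^n}|u|^2\le\frac{16}{(m-2)^2}\int_{\mathbb C^n}|v|^2\,d_H^2 .$$ -/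

import Mathlib

open MeasureTheory

/-- `ℂⁿ` with its Euclidean norm; as a real inner product space it is `ℝ²ⁿ`, and `volume` is
Lebesgue measure. -/
abbrev Cn (n : ℕ) : Type := EuclideanSpace ℂ (Fin n)

/-- Strictly increasing multi-indices `J = (j₁ < ⋯ < j_q)` with entries in `Fin n`, encoded by
their underlying sets. -/
abbrev MultiIndex (n q : ℕ) : Type := {J : Finset (Fin n) // J.card = q}

/-- A `(0,q)`-form `∑'_J u_J dz̄_J` on `ℂⁿ`, given by its coefficient functions with respect to
the frame `dz̄_J = dz̄_{j₁} ∧ ⋯ ∧ dz̄_{j_q}`, `j₁ < ⋯ < j_q`. No regularity is built in. -/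
abbrev AntiForm (n q : ℕ) : Type := MultiIndex n q → Cn n → ℂ

/-- The Wirtinger derivative `∂φ/∂z̄_j = ½ (∂φ/∂x_j + i ∂φ/∂y_j)`. -/
noncomputable def dzbar {n : ℕ} (j : Fin n) (φ : Cn n → ℂ) (z : Cn n) : ℂ :=
  (1 / 2 : ℂ) * (fderiv ℝ φ z (EuclideanSpace.single j 1)
    + Complex.I * fderiv ℝ φ z (EuclideanSpace.single j Complex.I))

/-- The multi-index `K ∖ {j}` for `j ∈ K`. -/
def MultiIndex.erase {n q : ℕ} (K : MultiIndex n (q + 1)) (j : K.1) : MultiIndex n q :=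
  ⟨K.1.erase j.1, by rw [Finset.card_erase_of_mem j.2, K.2]; rfl⟩

/-- The sign in `dz̄_j ∧ dz̄_{K ∖ {j}} = ± dz̄_K`: the parity of the number of entries of `K`
that are smaller than `j`. -/
def wedgeSign {n : ℕ} (j : Fin n) (K : Finset (Fin n)) : ℂ :=
  (-1) ^ (K.filter (fun k => k < j)).card

/-- `∂̄u = f` in the sense of distributions, for forms with locally integrable coefficients.
Since `∂̄u = ∑_J ∑_j (∂u_J/∂z̄_j) dz̄_j ∧ dz̄_J`, the coefficient of `∂̄u` at `K` is
`∑_{j ∈ K} ± ∂u_{K ∖ {j}}/∂z̄_j`; the derivatives are moved to a smooth compactly supported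
test function `φ`. -/
def IsDbar {n q : ℕ} (u : AntiForm n q) (f : AntiForm n (q + 1)) : Prop :=
  (∀ J, LocallyIntegrable (u J) volume) ∧ (∀ K, LocallyIntegrable (f K) volume) ∧
    ∀ (K : MultiIndex n (q + 1)) (φ : Cn n → ℂ),
      ContDiff ℝ (⊤ : ℕ∞) φ → HasCompactSupport φ →
        ∫ z, f K z * φ z =
          -∑ j : K.1, wedgeSign j.1 K.1 * ∫ z, u (K.erase j) z * dzbar j.1 φ z

/-- `∂̄v = 0` in the sense of distributions. -/
def IsDbarClosed {n q : ℕ} (v : AntiForm n q) : Prop :=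
  IsDbar v (fun _ _ => 0)

/-- The pointwise squared norm `|u|² = ∑'_J |u_J|²`. -/
noncomputable def AntiForm.normSq {n q : ℕ} (u : AntiForm n q) (z : Cn n) : ℝ :=
  ∑ J, ‖u J z‖ ^ 2

/-- `u` is a square integrable form: all its coefficients are in `L²`. -/
def AntiForm.IsL2 {n q : ℕ} (u : AntiForm n q) : Prop :=
  ∀ J, MemLp (u J) 2 volume

/-! On the Fourier side `∂̄` is the wedge product with the vector ζ = πiξ, and |ζ|² = π²|ξ|². If ζ ∧
v̂ = 0, the Koszul homotopy formula shows that contracting v̂ with ζ and dividing by |ζ|² gives a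
solution of ζ ∧ û = v̂; since contraction is adjoint to the wedge product, |û| = |v̂| / (π|ξ|) for ξ
≠ 0 (`exists_isDbar_of_fourier_eq`). It remains to bound v̂/|ξ| in L² by v·d_H, one coefficient f at
a time.

That bound is dual to the Hardy inequality ((m-2)/2)² ∫ |g|²/d_H² ≤ ∫ |∇g|² (`hardy_inequality`,
with weight 1/(d_H² + δ)). For g = 𝓕 h, Plancherel turns the right side into 4π² ∫ |ξ|²|h|².
Weighted Cauchy-Schwarz then gives |∫ 𝓕 h · f|² ≤ 16π²/(m-2)² · ∫ |f|² d_H² · ∫ |ξ|²|h|², and Riesz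
representation yields f̂ = |ξ|F with ∫ |F|² ≤ 16π²/(m-2)² ∫ |f|² d_H²
(`exists_fourier_eq_norm_mul`). The factor 1/π² from the symbol leaves 16/(m-2)².

The parameter δ > 0 removes the singularity of the weight along H; it tends to 0 only in the duality
estimate, where f ∈ L² makes the error δ ∫ |f|² vanish. -/

open SchwartzMap FourierTransform
open scoped LineDeriv

/-! ### Hardy inequality for an affine subspace. -/

section Hardy

variable {V : Type*} [NormedAddCommGroup V] [InnerProductSpace ℝ V] {ι : Type*} [Fintype ι]

/-- The squared distance to the affine subspace through `a` orthogonal to the family `e`. -/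
noncomputable def sqDist (e : ι → V) (a z : V) : ℝ := ∑ i, inner ℝ (e i) (z - a) ^ 2

lemma sqDist_nonneg (e : ι → V) (a z : V) : 0 ≤ sqDist e a z :=
  Finset.sum_nonneg fun _ _ => sq_nonneg _

lemma continuous_sqDist (e : ι → V) (a : V) : Continuous (sqDist e a) := by
  unfold sqDist; fun_prop

/-- The coordinates of the vector field used in the Hardy inequality. -/
noncomputable def hardyField (e : ι → V) (a : V) (δ : ℝ) (i : ι) (z : V) : ℝ :=
  inner ℝ (e i) (z - a) / (sqDist e a z + δ)

/-- By orthonormality only the i-th normal coordinate changes along `e i`, at unit speed; the rest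
is the quotient rule. -/
lemma hasLineDerivAt_hardyField {e : ι → V} (he : Orthonormal ℝ e) (a : V) {δ : ℝ} (hδ : 0 < δ)
    (i : ι) (z : V) :
    HasLineDerivAt ℝ (hardyField e a δ i)
      (1 / (sqDist e a z + δ) - 2 * inner ℝ (e i) (z - a) ^ 2 / (sqDist e a z + δ) ^ 2)
      z (e i) := by
  have hpos : 0 < sqDist e a z + δ := by linarith [sqDist_nonneg e a z]
  have hx : ∀ j, HasDerivAt (fun t : ℝ => inner ℝ (e j) (z + t • e i - a))
      (inner ℝ (e j) (e i)) 0 := by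
    intro j
    have : ∀ t : ℝ, inner ℝ (e j) (z + t • e i - a)
        = inner ℝ (e j) (z - a) + t * inner ℝ (e j) (e i) := by
      intro t
      rw [add_sub_right_comm, inner_add_right, inner_smul_right]
    simp_rw [this]
    simpa using ((hasDerivAt_id (0 : ℝ)).mul_const (inner ℝ (e j) (e i))).const_add
      (inner ℝ (e j) (z - a))
  classical
  have hd : HasDerivAt (fun t : ℝ => sqDist e a (z + t • e i) + δ)
      (2 * inner ℝ (e i) (z - a)) 0 := by
    have := (HasDerivAt.fun_sum (u := Finset.univ) fun j _ => (hx j).pow 2).add_const δ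
    refine this.congr_deriv ?_
    rw [Finset.sum_eq_single i]
    · simp [he.1 i]
    · intro j _ hj
      simp [he.2 hj]
    · simp
  have := (hx i).div hd (by simpa using hpos.ne')
  unfold HasLineDerivAt
  refine this.congr_deriv ?_
  simp only [zero_smul, add_zero, real_inner_self_eq_norm_sq, he.1 i]
  field_simp

lemma sum_hardyField_sq (e : ι → V) (a : V) (δ : ℝ) (z : V) :
    ∑ i, hardyField e a δ i z ^ 2 = sqDist e a z / (sqDist e a z + δ) ^ 2 := by
  simp [hardyField, div_pow, ← Finset.sum_div, sqDist]

lemma sq_inner_le_sqDist (e : ι → V) (a z : V) (i : ι) :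
    inner ℝ (e i) (z - a) ^ 2 ≤ sqDist e a z :=
  Finset.single_le_sum (f := fun i => inner ℝ (e i) (z - a) ^ 2) (fun _ _ => sq_nonneg _)
    (Finset.mem_univ i)

lemma continuous_hardyField (e : ι → V) (a : V) {δ : ℝ} (hδ : 0 < δ) (i : ι) :
    Continuous (hardyField e a δ i) := by
  unfold hardyField
  exact Continuous.div (by fun_prop) ((continuous_sqDist e a).add_const δ)
    fun z => by linarith [sqDist_nonneg e a z]

lemma abs_hardyField_le (e : ι → V) (a : V) {δ : ℝ} (hδ : 0 < δ) (i : ι) (z : V) :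
    |hardyField e a δ i z| ≤ 1 + 1 / δ := by
  have h0 := sqDist_nonneg e a z
  have hpos : 0 < sqDist e a z + δ := by linarith
  unfold hardyField
  rw [abs_div, abs_of_pos hpos, div_le_iff₀ hpos]
  have h1 := sq_inner_le_sqDist e a z i
  have h2 : |inner ℝ (e i) (z - a)| ≤ inner ℝ (e i) (z - a) ^ 2 + 1 := by
    nlinarith [sq_abs (inner ℝ (e i) (z - a)), sq_nonneg (|inner ℝ (e i) (z - a)| - 1),
      abs_nonneg (inner ℝ (e i) (z - a))]
  have h3 : (1 + 1 / δ) * (sqDist e a z + δ) = sqDist e a z + δ + sqDist e a z / δ + 1 := by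
    field_simp
    ring
  have : 0 ≤ sqDist e a z / δ := by positivity
  linarith

lemma abs_deriv_hardyField_le (e : ι → V) (a : V) {δ : ℝ} (hδ : 0 < δ) (i : ι) (z : V) :
    |1 / (sqDist e a z + δ) - 2 * inner ℝ (e i) (z - a) ^ 2 / (sqDist e a z + δ) ^ 2|
      ≤ 3 / δ := by
  have h0 := sqDist_nonneg e a z
  have hpos : 0 < sqDist e a z + δ := by linarith
  have h1 := sq_inner_le_sqDist e a z i
  have h2 : 1 / (sqDist e a z + δ) ≤ 1 / δ := one_div_le_one_div_of_le hδ (by linarith)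
  have h3 : 2 * inner ℝ (e i) (z - a) ^ 2 / (sqDist e a z + δ) ^ 2
      ≤ 2 * (1 / (sqDist e a z + δ)) := by
    rw [div_le_iff₀ (by positivity)]
    field_simp
    linarith
  have h4 : 0 ≤ 2 * inner ℝ (e i) (z - a) ^ 2 / (sqDist e a z + δ) ^ 2 := by positivity
  have h5 : 0 < 1 / (sqDist e a z + δ) := by positivity
  have h6 : 3 / δ = 3 * (1 / δ) := by ring
  rw [abs_le]
  constructor <;> linarith

/-- With ρ the squared distance and m = 2c + 2 normal directions, the right side minus the left is
exactly (c² + 2c)δ/(ρ + δ)². The value c = (m-2)/2 maximizes c(m-2) - c², the coefficient of 1/ρ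
that remains at δ = 0. -/
lemma hardy_pointwise (e : ι → V) (a : V) {δ : ℝ} (hδ : 0 < δ) (z : V) {c : ℝ}
    (hc : 2 * c = (Fintype.card ι : ℝ) - 2) (hc0 : 0 ≤ c) :
    c ^ 2 / (sqDist e a z + δ) ≤
      c * ∑ i, (1 / (sqDist e a z + δ) - 2 * inner ℝ (e i) (z - a) ^ 2 / (sqDist e a z + δ) ^ 2)
        - c ^ 2 * ∑ i, hardyField e a δ i z ^ 2 := by
  have h0 := sqDist_nonneg e a z
  have hpos : 0 < sqDist e a z + δ := by linarith
  have hm : (Fintype.card ι : ℝ) = 2 * c + 2 := by linarith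
  rw [sum_hardyField_sq, Finset.sum_sub_distrib, ← Finset.sum_div Finset.univ
    (fun i => 2 * inner ℝ (e i) (z - a) ^ 2), ← Finset.mul_sum]
  change _ ≤ c * (_ - 2 * sqDist e a z / _) - _
  rw [Finset.sum_const, nsmul_eq_mul, Finset.card_univ, hm]
  have : c * ((2 * c + 2) * (1 / (sqDist e a z + δ)) - 2 * sqDist e a z / (sqDist e a z + δ) ^ 2)
      - c ^ 2 * (sqDist e a z / (sqDist e a z + δ) ^ 2) - c ^ 2 / (sqDist e a z + δ)
      = (c ^ 2 + 2 * c) * δ / (sqDist e a z + δ) ^ 2 := by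
    field_simp
    ring
  have h2 : 0 ≤ (c ^ 2 + 2 * c) * δ / (sqDist e a z + δ) ^ 2 := by positivity
  linarith

variable [FiniteDimensional ℝ V] [MeasurableSpace V] [BorelSpace V]

/-- Integration by parts against ‖g‖², whose derivative is the factor 2⟨g, ∂g⟩. For δ > 0 the field
and its derivative are bounded, so all products are integrable and no boundary term appears. -/
lemma integral_hardyField_mul {e : ι → V} (he : Orthonormal ℝ e) (a : V) {δ : ℝ} (hδ : 0 < δ)
    (g : 𝓢(V, ℂ)) (i : ι) :
    Integrable (fun z => hardyField e a δ i z * (2 * inner ℝ (g z) (∂_{e i} g z))) ∧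
    Integrable (fun z => (1 / (sqDist e a z + δ) - 2 * inner ℝ (e i) (z - a) ^ 2
      / (sqDist e a z + δ) ^ 2) * ‖g z‖ ^ 2) ∧
    ∫ z, hardyField e a δ i z * (2 * inner ℝ (g z) (∂_{e i} g z))
      = -∫ z, (1 / (sqDist e a z + δ) - 2 * inner ℝ (e i) (z - a) ^ 2
        / (sqDist e a z + δ) ^ 2) * ‖g z‖ ^ 2 := by
  have hN : Integrable (fun z => ‖g z‖ ^ 2) := (g.memLp 2).integrable_norm_pow (by simp)
  have hI : Integrable (fun z => 2 * inner ℝ (g z) (∂_{e i} g z)) := by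
    refine Integrable.const_mul ?_ 2
    refine ((g.memLp 2).norm.integrable_mul ((∂_{e i} g).memLp 2).norm).mono'
      (g.continuous.inner (∂_{e i} g).continuous).aestronglyMeasurable
      (.of_forall fun z => norm_inner_le_norm (𝕜 := ℝ) (g z) (∂_{e i} g z))
  have hcont := continuous_hardyField e a hδ i
  have hsq := continuous_sqDist e a
  have hden : ∀ z, sqDist e a z + δ ≠ 0 := fun z => by linarith [sqDist_nonneg e a z]
  have h1 : Integrable (fun z => hardyField e a δ i z * (2 * inner ℝ (g z) (∂_{e i} g z))) :=
    hI.bdd_mul hcont.aestronglyMeasurable (.of_forall fun z => abs_hardyField_le e a hδ i z)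
  have h2 : Integrable (fun z => (1 / (sqDist e a z + δ) - 2 * inner ℝ (e i) (z - a) ^ 2
      / (sqDist e a z + δ) ^ 2) * ‖g z‖ ^ 2) := by
    refine hN.bdd_mul (Continuous.aestronglyMeasurable ?_)
      (.of_forall fun z => abs_deriv_hardyField_le e a hδ i z)
    refine (continuous_const.div (hsq.add_const δ) hden).sub
      (Continuous.div (by fun_prop) ((hsq.add_const δ).pow 2) fun z => pow_ne_zero 2 (hden z))
  refine ⟨h1, h2, ?_⟩
  refine integral_bilinear_hasLineDerivAt_right_eq_neg_left_of_integrable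
    (B := ContinuousLinearMap.mul ℝ ℝ) (v := e i) (f := hardyField e a δ i)
    (g := fun z => ‖g z‖ ^ 2) h2 h1 ?_
    (fun z _ => hasLineDerivAt_hardyField he a hδ i z) ?_
  · exact hN.bdd_mul hcont.aestronglyMeasurable
      (.of_forall fun z => abs_hardyField_le e a hδ i z)
  · intro z _
    have := ((g.hasFDerivAt z).norm_sq).hasLineDerivAt (e i)
    simpa [SchwartzMap.lineDerivOp_apply_eq_fderiv, mul_add] using this

/-- The Hardy inequality with respect to an affine subspace of codimension at least two, for
Schwartz functions and with a regularized weight. -/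
theorem hardy_inequality {e : ι → V} (he : Orthonormal ℝ e) (a : V) {δ : ℝ} (hδ : 0 < δ)
    (hm : 2 ≤ Fintype.card ι) (g : 𝓢(V, ℂ)) :
    (((Fintype.card ι : ℝ) - 2) / 2) ^ 2 * ∫ z, ‖g z‖ ^ 2 / (sqDist e a z + δ)
      ≤ ∑ i, ∫ z, ‖∂_{e i} g z‖ ^ 2 := by
  set c : ℝ := ((Fintype.card ι : ℝ) - 2) / 2 with hc
  have hc0 : 0 ≤ c := by
    have : (2 : ℝ) ≤ Fintype.card ι := by exact_mod_cast hm
    rw [hc]; linarith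
  have hN : Integrable (fun z => ‖g z‖ ^ 2) := (g.memLp 2).integrable_norm_pow (by simp)
  have hD : ∀ i, Integrable (fun z => ‖∂_{e i} g z‖ ^ 2) := fun i =>
    ((∂_{e i} g).memLp 2).integrable_norm_pow (by simp)
  have key := integral_hardyField_mul he a hδ g
  have hA : ∀ i, Integrable (fun z => hardyField e a δ i z ^ 2 * ‖g z‖ ^ 2) := by
    intro i
    refine hN.bdd_mul (c := (1 + 1 / δ) ^ 2)
      ((continuous_hardyField e a hδ i).pow 2).aestronglyMeasurable (.of_forall fun z => ?_)
    rw [norm_pow]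
    exact pow_le_pow_left₀ (norm_nonneg _) (abs_hardyField_le e a hδ i z) 2
  have hsquare : ∀ i, 0 ≤ (∫ z, ‖∂_{e i} g z‖ ^ 2)
      - c * (∫ z, (1 / (sqDist e a z + δ) - 2 * inner ℝ (e i) (z - a) ^ 2
        / (sqDist e a z + δ) ^ 2) * ‖g z‖ ^ 2)
      + c ^ 2 * ∫ z, hardyField e a δ i z ^ 2 * ‖g z‖ ^ 2 := by
    intro i
    obtain ⟨h1, h2, h3⟩ := key i
    -- The integrand is ‖∂g + cXg‖² with X the Hardy field; its cross term is then integrated by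
    -- parts.
    have : 0 ≤ ∫ z, (‖∂_{e i} g z‖ ^ 2
        + c * (hardyField e a δ i z * (2 * inner ℝ (g z) (∂_{e i} g z)))
        + c ^ 2 * (hardyField e a δ i z ^ 2 * ‖g z‖ ^ 2)) := by
      refine integral_nonneg fun z => ?_
      have := norm_add_sq_real (∂_{e i} g z) ((c * hardyField e a δ i z) • g z)
      rw [inner_smul_right, norm_smul, mul_pow, Real.norm_eq_abs, sq_abs,
        real_inner_comm] at this
      have h := sq_nonneg ‖∂_{e i} g z + (c * hardyField e a δ i z) • g z‖
      simp only [Pi.zero_apply]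
      rw [this] at h
      linarith
    rw [integral_add (by exact (hD i).add (h1.const_mul c)) ((hA i).const_mul _),
      integral_add (hD i) (h1.const_mul c), integral_const_mul, integral_const_mul, h3] at this
    linarith
  have hsum := Finset.sum_nonneg fun i (_ : i ∈ Finset.univ) => hsquare i
  rw [Finset.sum_add_distrib, Finset.sum_sub_distrib, ← Finset.mul_sum, ← Finset.mul_sum,
    ← integral_finsetSum _ fun i _ => (key i).2.1, ← integral_finsetSum _ fun i _ => hA i] at hsum
  have hmono : c ^ 2 * ∫ z, ‖g z‖ ^ 2 / (sqDist e a z + δ) ≤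
      c * (∫ z, ∑ i, (1 / (sqDist e a z + δ) - 2 * inner ℝ (e i) (z - a) ^ 2
        / (sqDist e a z + δ) ^ 2) * ‖g z‖ ^ 2)
      - c ^ 2 * ∫ z, ∑ i, hardyField e a δ i z ^ 2 * ‖g z‖ ^ 2 := by
    have i1 := (integrable_finsetSum Finset.univ fun i _ => (key i).2.1).const_mul c
    have i2 := (integrable_finsetSum Finset.univ fun i _ => hA i).const_mul (c ^ 2)
    rw [← integral_const_mul, ← integral_const_mul, ← integral_const_mul, ← integral_sub i1 i2]
    refine integral_mono_of_nonneg (.of_forall fun z => ?_) (i1.sub i2) (.of_forall fun z => ?_)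
    · have := sqDist_nonneg e a z
      simp only [Pi.zero_apply]
      positivity
    · have := mul_le_mul_of_nonneg_right
        (hardy_pointwise e a hδ z (c := c) (by rw [hc]; ring) hc0) (sq_nonneg ‖g z‖)
      simp only [← Finset.sum_mul]
      calc _ = c ^ 2 / (sqDist e a z + δ) * ‖g z‖ ^ 2 := by ring
        _ ≤ _ := this
        _ = _ := by ring
  linarith

end Hardy

/-! ### Duality in Hilbert space and weighted Cauchy-Schwarz. -/

section Duality

/-- A linear functional dominated by the norm of a linear map into a Hilbert space is represented
by a vector of that space. -/
lemma exists_inner_eq_of_norm_le {M E : Type*} [AddCommGroup M] [Module ℂ M]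
    [NormedAddCommGroup E] [InnerProductSpace ℂ E] [CompleteSpace E] (T : M →ₗ[ℂ] E)
    (l : M →ₗ[ℂ] ℂ) {C : ℝ} (hC : 0 ≤ C) (h : ∀ x, ‖l x‖ ≤ C * ‖T x‖) :
    ∃ F : E, ‖F‖ ≤ C ∧ ∀ x, l x = inner ℂ F (T x) := by
  -- The bound makes `l` factor through the range of `T`. That range need not be closed, so
  -- Hahn-Banach extends the functional before Riesz is applied.
  have hker : LinearMap.ker T ≤ LinearMap.ker l := by
    intro x hx
    have := h x
    rw [LinearMap.mem_ker.1 hx, norm_zero, mul_zero] at this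
    exact norm_le_zero_iff.1 this
  let l₀ : LinearMap.range T →ₗ[ℂ] ℂ :=
    ((LinearMap.ker T).liftQ l hker).comp T.quotKerEquivRange.symm.toLinearMap
  have hl₀ : ∀ x, l₀ ⟨T x, x, rfl⟩ = l x := by
    intro x
    have : T.quotKerEquivRange.symm ⟨T x, x, rfl⟩ = (LinearMap.ker T).mkQ x := by
      rw [LinearEquiv.symm_apply_eq]; rfl
    simp only [l₀, LinearMap.comp_apply, LinearEquiv.coe_coe]
    rw [this]
    rfl
  let l₁ : StrongDual ℂ (LinearMap.range T) := l₀.mkContinuous C (by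
    rintro ⟨_, x, rfl⟩
    rw [hl₀]
    exact h x)
  obtain ⟨g, hg, hgn⟩ := exists_extension_norm_eq _ l₁
  refine ⟨(InnerProductSpace.toDual ℂ E).symm g, ?_, fun x => ?_⟩
  · rw [LinearIsometryEquiv.norm_map, hgn]
    exact LinearMap.mkContinuous_norm_le _ hC _
  · rw [InnerProductSpace.toDual_symm_apply]
    exact ((hg ⟨T x, x, rfl⟩).trans (hl₀ x)).symm

/-- The Cauchy-Schwarz inequality with a positive weight. -/
lemma sq_norm_integral_mul_le {α : Type*} [MeasurableSpace α] {μ : Measure α} {f g : α → ℂ}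
    {w : α → ℝ} (hw : Measurable w) (hw0 : ∀ x, 0 < w x) (hf : AEStronglyMeasurable f μ)
    (hg : AEStronglyMeasurable g μ) (hfw : Integrable (fun x => ‖f x‖ ^ 2 * w x) μ)
    (hgw : Integrable (fun x => ‖g x‖ ^ 2 / w x) μ) :
    ‖∫ x, g x * f x ∂μ‖ ^ 2 ≤ (∫ x, ‖f x‖ ^ 2 * w x ∂μ) * ∫ x, ‖g x‖ ^ 2 / w x ∂μ := by
  have e1 : ∀ x, (‖f x‖ * √(w x)) ^ 2 = ‖f x‖ ^ 2 * w x := fun x => by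
    rw [mul_pow, Real.sq_sqrt (hw0 x).le]
  have e2 : ∀ x, (‖g x‖ / √(w x)) ^ 2 = ‖g x‖ ^ 2 / w x := fun x => by
    rw [div_pow, Real.sq_sqrt (hw0 x).le]
  have m1 : MemLp (fun x => ‖f x‖ * √(w x)) 2 μ := by
    refine (memLp_two_iff_integrable_sq (hf.norm.mul hw.sqrt.aestronglyMeasurable)).2 ?_
    simpa only [Pi.mul_apply, e1] using hfw
  have m2 : MemLp (fun x => ‖g x‖ / √(w x)) 2 μ := by
    refine (memLp_two_iff_integrable_sq
      (hg.norm.aemeasurable.div hw.sqrt.aemeasurable).aestronglyMeasurable).2 ?_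
    simpa only [Pi.div_apply, e2] using hgw
  have h := integral_mul_le_Lp_mul_Lq_of_nonneg (μ := μ) Real.HolderConjugate.two_two
    (f := fun x => ‖f x‖ * √(w x)) (g := fun x => ‖g x‖ / √(w x))
    (.of_forall fun x => mul_nonneg (norm_nonneg _) (Real.sqrt_nonneg _))
    (.of_forall fun x => div_nonneg (norm_nonneg _) (Real.sqrt_nonneg _))
    (by simpa using m1) (by simpa using m2)
  have h0 : ‖∫ x, g x * f x ∂μ‖ ≤ ∫ x, ‖f x‖ * √(w x) * (‖g x‖ / √(w x)) ∂μ := by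
    refine (norm_integral_le_integral_norm _).trans_eq ?_
    congr 1 with x
    have : √(w x) ≠ 0 := (Real.sqrt_pos.2 (hw0 x)).ne'
    rw [norm_mul]
    field_simp
  simp only [Real.rpow_two, e1, e2, ← Real.sqrt_eq_rpow] at h
  calc _ ≤ (√(∫ x, ‖f x‖ ^ 2 * w x ∂μ) * √(∫ x, ‖g x‖ ^ 2 / w x ∂μ)) ^ 2 :=
        pow_le_pow_left₀ (norm_nonneg _) (h0.trans h) 2
    _ = _ := by
        rw [mul_pow, Real.sq_sqrt, Real.sq_sqrt]
        · exact integral_nonneg fun x => div_nonneg (sq_nonneg _) (hw0 x).le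
        · exact integral_nonneg fun x => mul_nonneg (sq_nonneg _) (hw0 x).le

/-! ### Divisibility of the Fourier transform by the norm. -/

variable {V : Type*} [NormedAddCommGroup V] [InnerProductSpace ℝ V] [FiniteDimensional ℝ V]
  [MeasurableSpace V] [BorelSpace V]

/-- The transposition formula for the Fourier transform of an `L²` function. -/
lemma integral_mul_fourier_eq (f : Lp (α := V) ℂ 2) (h : 𝓢(V, ℂ)) :
    ∫ x, h x * (𝓕 f : Lp (α := V) ℂ 2) x = ∫ x, 𝓕 h x * f x := by
  have := congr($(Lp.fourier_toTemperedDistribution_eq f) h)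
  rw [TemperedDistribution.fourier_apply] at this
  simpa using this.symm

lemma lineDeriv_fourier_symbol (w : V) (h : 𝓢(V, ℂ)) :
    ∃ G : 𝓢(V, ℂ), ∂_{w} (𝓕 h) = 𝓕 G ∧
      ∀ x, G x = -(2 * Real.pi * Complex.I) * (inner ℝ x w : ℝ) * h x := by
  refine ⟨_, SchwartzMap.lineDerivOp_fourier_eq h w, fun x => ?_⟩
  rw [smul_apply, SchwartzMap.smulLeftCLM_apply_apply (by fun_prop), smul_eq_mul,
    Complex.real_smul]
  ring

lemma integral_norm_sq_lineDeriv_fourier (w : V) (h : 𝓢(V, ℂ)) :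
    Integrable (fun x => inner ℝ w x ^ 2 * ‖h x‖ ^ 2) ∧
    ∫ x, ‖∂_{w} (𝓕 h) x‖ ^ 2 = 4 * Real.pi ^ 2 * ∫ x, inner ℝ w x ^ 2 * ‖h x‖ ^ 2 := by
  obtain ⟨G, hG, hGx⟩ := lineDeriv_fourier_symbol w h
  have e : ∀ x, ‖G x‖ ^ 2 = 4 * Real.pi ^ 2 * (inner ℝ w x ^ 2 * ‖h x‖ ^ 2) := by
    intro x
    rw [hGx, norm_mul, norm_mul, mul_pow, mul_pow, real_inner_comm, Complex.norm_real,
      Real.norm_eq_abs, sq_abs]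
    simp only [norm_neg, norm_mul, Complex.norm_I, Complex.norm_real, Real.norm_eq_abs, mul_pow,
      sq_abs, Complex.norm_ofNat]
    ring
  have hi : Integrable (fun x => ‖G x‖ ^ 2) := (G.memLp 2).integrable_norm_pow (by simp)
  simp only [e] at hi
  refine ⟨(integrable_const_mul_iff (Ne.isUnit (by positivity)) _).1 hi, ?_⟩
  rw [hG, SchwartzMap.integral_norm_sq_fourier, ← integral_const_mul]
  simp only [e]

/-- Multiplication by `‖x‖`, from Schwartz functions to `L²`. -/
lemma memLp_norm_mul (h : 𝓢(V, ℂ)) : MemLp (fun x => (‖x‖ : ℂ) * h x) 2 volume := by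
  -- The norm is not smooth at the origin, so it is dominated by a smooth multiplier of temperate
  -- growth.
  have ht : (fun x : V => (1 + ‖x‖ ^ 2 : ℝ)).HasTemperateGrowth := by fun_prop
  refine ((SchwartzMap.smulLeftCLM ℂ (fun x : V => (1 + ‖x‖ ^ 2 : ℝ)) h).memLp 2).mono
    ((Complex.continuous_ofReal.comp continuous_norm).mul h.continuous).aestronglyMeasurable
    (.of_forall fun x => ?_)
  change ‖(‖x‖ : ℂ) * h x‖ ≤ _
  rw [SchwartzMap.smulLeftCLM_apply_apply ht, norm_smul, norm_mul]
  refine mul_le_mul_of_nonneg_right ?_ (norm_nonneg _)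
  rw [Complex.norm_real, norm_norm, Real.norm_of_nonneg (by positivity)]
  nlinarith [sq_nonneg (‖x‖ - 1)]

/-- Multiplication by `‖x‖`, from Schwartz functions to `L²`. -/
noncomputable def normMulLp : 𝓢(V, ℂ) →ₗ[ℂ] Lp (α := V) ℂ 2 where
  toFun h := (memLp_norm_mul h).toLp _
  map_add' h k := by
    rw [← MemLp.toLp_add]
    exact MemLp.toLp_congr _ _ (.of_forall fun x => by simp [mul_add])
  map_smul' c h := by
    rw [RingHom.id_apply, ← MemLp.toLp_const_smul]
    exact MemLp.toLp_congr _ _ (.of_forall fun x => by simp [mul_left_comm])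

lemma norm_sq_toLp {f : V → ℂ} (hf : MemLp f 2 volume) :
    ‖hf.toLp f‖ ^ 2 = ∫ x, ‖f x‖ ^ 2 := by
  have : ((‖hf.toLp f‖ ^ 2 : ℝ) : ℂ) = ((∫ x, ‖f x‖ ^ 2 : ℝ) : ℂ) := by
    have := inner_self_eq_norm_sq_to_K (𝕜 := ℂ) (hf.toLp f)
    rw [L2.inner_def] at this
    rw [Complex.ofReal_pow]
    refine this.symm.trans ?_
    rw [← integral_complex_ofReal]
    refine integral_congr_ae ?_
    filter_upwards [hf.coeFn_toLp] with x hx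
    rw [hx, inner_self_eq_norm_sq_to_K]
    simp
  exact_mod_cast this

variable {ι : Type*} [Fintype ι]

/-- The Hardy inequality for a Fourier transform, with the gradient expressed through Plancherel's
theorem. -/
lemma hardy_fourier {e : ι → V} (he : Orthonormal ℝ e) (a : V) {δ : ℝ} (hδ : 0 < δ)
    (hm : 2 < Fintype.card ι) (h : 𝓢(V, ℂ)) :
    ∫ z, ‖𝓕 h z‖ ^ 2 / (sqDist e a z + δ)
      ≤ 16 * Real.pi ^ 2 / ((Fintype.card ι : ℝ) - 2) ^ 2 * ‖normMulLp h‖ ^ 2 := by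
  have hH := hardy_inequality he a hδ hm.le (𝓕 h)
  have hm' : (0 : ℝ) < (Fintype.card ι : ℝ) - 2 := by
    have : (2 : ℝ) < Fintype.card ι := by exact_mod_cast hm
    linarith
  have hi : Integrable (fun x => ‖x‖ ^ 2 * ‖h x‖ ^ 2) := by
    refine ((memLp_norm_mul h).integrable_norm_pow (by simp)).congr (.of_forall fun x => ?_)
    simp [mul_pow]
  have hT : ‖normMulLp h‖ ^ 2 = ∫ x, ‖x‖ ^ 2 * ‖h x‖ ^ 2 := by
    change ‖(memLp_norm_mul h).toLp _‖ ^ 2 = _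
    rw [norm_sq_toLp]
    simp [mul_pow]
  have hb : ∑ i, ∫ z, ‖∂_{e i} (𝓕 h) z‖ ^ 2 ≤ 4 * Real.pi ^ 2 * ‖normMulLp h‖ ^ 2 := by
    simp only [fun i => (integral_norm_sq_lineDeriv_fourier (e i) h).2]
    rw [← Finset.mul_sum, hT,
      ← integral_finsetSum _ fun i _ => (integral_norm_sq_lineDeriv_fourier (e i) h).1]
    refine mul_le_mul_of_nonneg_left (integral_mono (integrable_finsetSum _ fun i _ =>
      (integral_norm_sq_lineDeriv_fourier (e i) h).1) hi fun x => ?_) (by positivity)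
    simp only [← Finset.sum_mul]
    refine mul_le_mul_of_nonneg_right ?_ (sq_nonneg _)
    -- Bessel's inequality: the normal part of the gradient is bounded by the full gradient.
    simpa [sq_abs] using he.sum_inner_products_le (s := Finset.univ) x
  have := hH.trans hb
  rw [div_mul_eq_mul_div, le_div_iff₀ (by positivity)]
  linarith

/-- If `f` and `f · d` are square integrable, where `d` is the distance to an affine subspace of
codimension at least three, then the Fourier transform of `f` is `‖ξ‖ F` with `F` in `L²`. -/
theorem exists_fourier_eq_norm_mul {e : ι → V} (he : Orthonormal ℝ e) (a : V)
    (hm : 2 < Fintype.card ι) {f : V → ℂ} (hf : MemLp f 2 volume)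
    (hfd : Integrable (fun z => ‖f z‖ ^ 2 * sqDist e a z)) :
    ∃ F : V → ℂ, MemLp F 2 volume ∧
      ∫ z, ‖F z‖ ^ 2 ≤ 16 * Real.pi ^ 2 / ((Fintype.card ι : ℝ) - 2) ^ 2 *
        ∫ z, ‖f z‖ ^ 2 * sqDist e a z ∧
      ∀ᵐ ξ, (𝓕 (hf.toLp f : Lp (α := V) ℂ 2 volume) : Lp (α := V) ℂ 2 volume) ξ = ‖ξ‖ * F ξ := by
  set A : ℝ := 16 * Real.pi ^ 2 / ((Fintype.card ι : ℝ) - 2) ^ 2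
  have hA0 : 0 ≤ A := by positivity
  set B : ℝ := ∫ z, ‖f z‖ ^ 2 * sqDist e a z
  have hB0 : 0 ≤ B := integral_nonneg fun z => mul_nonneg (sq_nonneg _) (sqDist_nonneg e a z)
  have hf2 : Integrable (fun z => ‖f z‖ ^ 2) := hf.integrable_norm_pow two_ne_zero
  have hint : ∀ h : 𝓢(V, ℂ), Integrable (fun z => 𝓕 h z * f z) := fun h =>
    ((𝓕 h).memLp 2 volume).integrable_mul hf
  let l : 𝓢(V, ℂ) →ₗ[ℂ] ℂ :=
    { toFun := fun h => ∫ z, 𝓕 h z * f z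
      map_add' := fun h k => by
        rw [← integral_add (hint h) (hint k)]
        simp only [FourierTransform.fourier_add, add_apply, add_mul]
      map_smul' := fun c h => by
        rw [RingHom.id_apply, smul_eq_mul, ← integral_const_mul]
        simp only [FourierTransform.fourier_smul, smul_apply, smul_eq_mul, mul_assoc] }
  have hl : ∀ h, ‖l h‖ ^ 2 ≤ A * B * ‖normMulLp h‖ ^ 2 := by
    intro h
    -- Cauchy-Schwarz with weight d² + δ, then Hardy for `𝓕 h`. The right side is affine in δ, so
    -- letting δ tend to 0 removes the regularization.
    have hδ : ∀ δ : ℝ, 0 < δ → ‖l h‖ ^ 2 ≤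
        (B + δ * ∫ z, ‖f z‖ ^ 2) * (A * ‖normMulLp h‖ ^ 2) := by
      intro δ hδ
      have hpos : ∀ z, 0 < sqDist e a z + δ := fun z => by linarith [sqDist_nonneg e a z]
      have hcont := (continuous_sqDist e a).add_const δ
      have i1 : Integrable (fun z => ‖f z‖ ^ 2 * (sqDist e a z + δ)) := by
        simp only [mul_add]
        exact hfd.add (hf2.mul_const δ)
      have i2 : Integrable (fun z => ‖𝓕 h z‖ ^ 2 / (sqDist e a z + δ)) := by
        simp only [div_eq_mul_inv]
        refine (((𝓕 h).memLp 2 volume).integrable_norm_pow two_ne_zero).mul_bdd (c := δ⁻¹)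
          (hcont.inv₀ fun z => (hpos z).ne').aestronglyMeasurable (.of_forall fun z => ?_)
        rw [norm_inv, Real.norm_of_nonneg (hpos z).le]
        exact inv_anti₀ hδ (by linarith [sqDist_nonneg e a z])
      have := sq_norm_integral_mul_le hcont.measurable hpos hf.1
        (𝓕 h).continuous.aestronglyMeasurable i1 i2
      refine this.trans ?_
      have e1 : ∫ z, ‖f z‖ ^ 2 * (sqDist e a z + δ) = B + δ * ∫ z, ‖f z‖ ^ 2 := by
        simp only [mul_add]
        rw [integral_add hfd (hf2.mul_const δ), integral_mul_const, mul_comm δ]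
      rw [e1]
      refine mul_le_mul_of_nonneg_left (hardy_fourier he a hδ hm h) ?_
      rw [← e1]
      exact integral_nonneg fun z => mul_nonneg (sq_nonneg _) (hpos z).le
    have ht : Filter.Tendsto (fun δ : ℝ => (B + δ * ∫ z, ‖f z‖ ^ 2) * (A * ‖normMulLp h‖ ^ 2))
        (nhdsWithin 0 (Set.Ioi 0)) (nhds ((B + 0 * ∫ z, ‖f z‖ ^ 2) * (A * ‖normMulLp h‖ ^ 2))) :=
      Filter.Tendsto.mono_left (Continuous.tendsto (by fun_prop) 0) nhdsWithin_le_nhds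
    have := ge_of_tendsto ht (eventually_nhdsWithin_of_forall fun δ h => hδ δ h)
    calc _ ≤ _ := this
      _ = _ := by ring
  have hl' : ∀ h, ‖l h‖ ≤ √(A * B) * ‖normMulLp h‖ := by
    intro h
    rw [← Real.sqrt_sq (norm_nonneg (normMulLp h)), ← Real.sqrt_mul (by positivity)]
    exact Real.le_sqrt_of_sq_le (hl h)
  obtain ⟨F₀, hF₀, hF₀l⟩ := exists_inner_eq_of_norm_le normMulLp l (Real.sqrt_nonneg _) hl'
  -- The pairing `∫ 𝓕 h * f` is bilinear, whereas the inner product is antilinear in its first slot;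
  -- hence the conjugate.
  have hFm : MemLp (fun z => (starRingEnd ℂ) (F₀ z)) 2 volume := (Lp.memLp F₀).star
  refine ⟨fun z => (starRingEnd ℂ) (F₀ z), hFm, ?_, ?_⟩
  · simp only [RCLike.norm_conj]
    rw [← norm_sq_toLp (Lp.memLp F₀), Lp.toLp_coeFn]
    calc _ ≤ √(A * B) ^ 2 := pow_le_pow_left₀ (norm_nonneg _) hF₀ 2
      _ = _ := Real.sq_sqrt (by positivity)
  · refine ae_eq_of_integral_contDiff_smul_eq ((Lp.memLp _).locallyIntegrable (by norm_num)) ?_ ?_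
    · have := (hFm.locallyIntegrable (by norm_num)).locallyIntegrableOn Set.univ
      rw [← locallyIntegrableOn_univ]
      exact this.continuousOn_mul (g := fun z => ((‖z‖ : ℝ) : ℂ)) (by fun_prop)
        isOpen_univ.isLocallyClosed
    · intro g hg hgc
      have hg₁ : HasCompactSupport (Complex.ofRealCLM ∘ g) := hgc.comp_left rfl
      have hg₂ : ContDiff ℝ (⊤ : ℕ∞) (Complex.ofRealCLM ∘ g) := by fun_prop
      set h : 𝓢(V, ℂ) := hg₁.toSchwartzMap hg₂
      have hhx : ∀ x, h x = (g x : ℂ) := fun x => rfl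
      have h1 := integral_mul_fourier_eq (hf.toLp f) h
      have h2 : ∫ x, 𝓕 h x * hf.toLp f x = l h := by
        refine integral_congr_ae ?_
        filter_upwards [hf.coeFn_toLp] with x hx
        rw [hx]
      rw [h2, hF₀l, L2.inner_def] at h1
      simp only [hhx] at h1
      simp only [Complex.real_smul]
      refine h1.trans (integral_congr_ae ?_)
      filter_upwards [(memLp_norm_mul h).coeFn_toLp] with x hx
      change inner ℂ (F₀ x) ((memLp_norm_mul h).toLp _ x) = _
      rw [hx, hhx, RCLike.inner_apply]
      ring

end Duality

/-! ### Approximation of Schwartz functions by test functions. -/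

section Cutoff

variable {V : Type*} [NormedAddCommGroup V] [InnerProductSpace ℝ V] [FiniteDimensional ℝ V]
  [MeasurableSpace V] [BorelSpace V]

/-- Schwartz functions are limits of test functions, as far as pairings of first derivatives with
`L²` functions are concerned. -/
theorem exists_testFunction_tendsto (ψ : 𝓢(V, ℂ)) :
    ∃ φ : ℕ → V → ℂ, (∀ k, ContDiff ℝ (⊤ : ℕ∞) (φ k) ∧ HasCompactSupport (φ k)) ∧
      ∀ (f : V → ℂ) (w : V), MemLp f 2 volume →
        Integrable (fun z => f z * fderiv ℝ ψ z w) ∧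
        (∀ k, Integrable (fun z => f z * fderiv ℝ (φ k) z w)) ∧
        Filter.Tendsto (fun k => ∫ z, f z * fderiv ℝ (φ k) z w) Filter.atTop
          (nhds (∫ z, f z * fderiv ℝ ψ z w)) := by
  let χ : ContDiffBump (0 : V) := ⟨1, 2, one_pos, one_lt_two⟩
  have hχ : ContDiff ℝ (⊤ : ℕ∞) χ := χ.contDiff
  obtain ⟨C, hC⟩ := (χ.hasCompactSupport.fderiv (𝕜 := ℝ)).exists_bound_of_continuous
    (hχ.continuous_fderiv (by simp))
  have hC0 : 0 ≤ C := (norm_nonneg _).trans (hC 0)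
  let s : ℕ → ℝ := fun k => ((k : ℝ) + 1)⁻¹
  have hs0 : ∀ k, 0 < s k := fun k => by positivity
  have hs1 : ∀ k, s k ≤ 1 := fun k => inv_le_one_of_one_le₀ (by simp)
  let χk : ℕ → V → ℝ := fun k z => χ (s k • z)
  have hχk : ∀ k, ContDiff ℝ (⊤ : ℕ∞) (χk k) := fun k => hχ.comp (contDiff_const_smul (s k))
  let φ : ℕ → V → ℂ := fun k z => χk k z • ψ z
  have hφ : ∀ k, ContDiff ℝ (⊤ : ℕ∞) (φ k) := fun k => (hχk k).smul (ψ.smooth ⊤)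
  have hφc : ∀ k, HasCompactSupport (φ k) := fun k =>
    (χ.hasCompactSupport.comp_smul (hs0 k).ne').smul_right
  have hψd : ∀ z, DifferentiableAt ℝ ψ z := fun z => ψ.differentiableAt
  have hχd : ∀ k z, HasFDerivAt (χk k) ((fderiv ℝ χ (s k • z)).comp
      (s k • ContinuousLinearMap.id ℝ V)) z := fun k z =>
    ((hχ.differentiable (by simp)).differentiableAt.hasFDerivAt (x := s k • z)).comp z
      ((hasFDerivAt_id z).const_smul (s k))
  have hder : ∀ k z w, fderiv ℝ (φ k) z w
      = χk k z • fderiv ℝ ψ z w + (s k * fderiv ℝ χ (s k • z) w) • ψ z := by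
    intro k z w
    have := ((hχd k z).smul (hψd z).hasFDerivAt).fderiv
    change fderiv ℝ (χk k • ⇑ψ) z w = _
    rw [this]
    simp
  have hbound : ∀ k z w, ‖fderiv ℝ (φ k) z w‖ ≤ ‖fderiv ℝ ψ z w‖ + C * ‖w‖ * ‖ψ z‖ := by
    intro k z w
    rw [hder]
    refine (norm_add_le _ _).trans (add_le_add ?_ ?_)
    · rw [norm_smul, Real.norm_of_nonneg χ.nonneg]
      exact mul_le_of_le_one_left (norm_nonneg _) χ.le_one
    · rw [norm_smul, norm_mul, Real.norm_of_nonneg (hs0 k).le]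
      refine mul_le_mul_of_nonneg_right ?_ (norm_nonneg _)
      calc s k * ‖fderiv ℝ χ (s k • z) w‖ ≤ 1 * (‖fderiv ℝ χ (s k • z)‖ * ‖w‖) :=
            mul_le_mul (hs1 k) (ContinuousLinearMap.le_opNorm _ _) (norm_nonneg _) zero_le_one
        _ ≤ C * ‖w‖ := by
            rw [one_mul]; exact mul_le_mul_of_nonneg_right (hC _) (norm_nonneg _)
  -- The dilated cutoff is eventually 1 near any given point, so the derivatives there are
  -- eventually equal, and dominated convergence applies.
  have hlim : ∀ z w, ∀ᶠ k in Filter.atTop, fderiv ℝ (φ k) z w = fderiv ℝ ψ z w := by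
    intro z w
    filter_upwards [Filter.eventually_ge_atTop ⌈‖z‖⌉₊] with k hk
    have hz : s k * ‖z‖ < 1 := by
      rw [inv_mul_lt_one₀ (by positivity)]
      linarith [Nat.le_ceil ‖z‖, (Nat.cast_le (α := ℝ)).2 hk]
    have : φ k =ᶠ[nhds z] ψ := by
      have : ∀ᶠ y in nhds z, s k * ‖y‖ < 1 :=
        (continuous_const.mul continuous_norm).continuousAt.eventually_lt continuousAt_const hz
      filter_upwards [this] with y hy
      have : χk k y = 1 := χ.one_of_mem_closedBall (by
        rw [mem_closedBall_zero_iff, norm_smul, Real.norm_of_nonneg (hs0 k).le]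
        exact hy.le)
      simp [φ, this]
    rw [this.fderiv_eq]
  refine ⟨φ, fun k => ⟨hφ k, hφc k⟩, fun f w hf => ?_⟩
  have hm : MemLp (fun z => fderiv ℝ ψ z w) 2 volume :=
    MemLp.ae_eq (.of_forall fun z => SchwartzMap.lineDerivOp_apply_eq_fderiv w ψ z)
      ((∂_{w} ψ).memLp 2)
  have hdom : Integrable (fun z => ‖f z‖ * (‖fderiv ℝ ψ z w‖ + C * ‖w‖ * ‖ψ z‖)) :=
    hf.norm.integrable_mul (hm.norm.add ((ψ.memLp 2).norm.const_mul (C * ‖w‖)))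
  have hmeas : ∀ k, AEStronglyMeasurable (fun z => f z * fderiv ℝ (φ k) z w) volume := fun k =>
    hf.1.mul (((hφ k).continuous_fderiv (by simp)).clm_apply
      continuous_const).aestronglyMeasurable
  have hle : ∀ k z, ‖f z * fderiv ℝ (φ k) z w‖
      ≤ ‖f z‖ * (‖fderiv ℝ ψ z w‖ + C * ‖w‖ * ‖ψ z‖) := fun k z => by
    rw [norm_mul]
    exact mul_le_mul_of_nonneg_left (hbound k z w) (norm_nonneg _)
  refine ⟨hf.integrable_mul hm, fun k => hdom.mono' (hmeas k) (.of_forall (hle k)), ?_⟩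
  refine tendsto_integral_of_dominated_convergence _ hmeas hdom
    (fun k => .of_forall (hle k)) (.of_forall fun z => ?_)
  refine tendsto_const_nhds.congr' ?_
  filter_upwards [hlim z w] with k hk
  rw [hk]

end Cutoff

/-! ### Koszul algebra of wedge product and contraction. -/

section ExteriorAlgebra

variable {n : ℕ}

lemma wedgeSign_insert {j k : Fin n} {K : Finset (Fin n)} (hk : k ∉ K) :
    wedgeSign j (insert k K) = (if k < j then -1 else 1) * wedgeSign j K := by
  unfold wedgeSign
  rw [Finset.filter_insert]
  split_ifs with h
  · rw [Finset.card_insert_of_notMem (by simp [hk]), pow_succ]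
    ring
  · simp

lemma wedgeSign_insert_self {j : Fin n} {K : Finset (Fin n)} :
    wedgeSign j (insert j K) = wedgeSign j K := by
  unfold wedgeSign
  simp [Finset.filter_insert]

lemma wedgeSign_mul_self (j : Fin n) (K : Finset (Fin n)) :
    wedgeSign j K * wedgeSign j K = 1 := by
  unfold wedgeSign
  rw [← mul_pow]; simp

lemma conj_wedgeSign (j : Fin n) (K : Finset (Fin n)) :
    (starRingEnd ℂ) (wedgeSign j K) = wedgeSign j K := by
  unfold wedgeSign
  simp

/-- The coefficients of `ζ ∧ a`. -/
noncomputable def wedgeCoeff (ζ : Fin n → ℂ) (a : Finset (Fin n) → ℂ) (K : Finset (Fin n)) : ℂ :=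
  ∑ j ∈ K, wedgeSign j K * ζ j * a (K.erase j)

/-- The coefficients of the contraction of `a` with `ζ`, the adjoint of `wedgeCoeff ζ`. -/
noncomputable def contractCoeff (ζ : Fin n → ℂ) (a : Finset (Fin n) → ℂ) (I : Finset (Fin n)) :
    ℂ :=
  ∑ k ∈ Iᶜ, wedgeSign k I * (starRingEnd ℂ) (ζ k) * a (insert k I)

/-- Exactly one of j < k and k < j holds, so removing j and adding k in the two orders costs
opposite signs. This cancels the off-diagonal terms of the homotopy formula. -/
lemma wedgeSign_anticomm {j k : Fin n} {K : Finset (Fin n)} (hj : j ∈ K) (hk : k ∉ K) :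
    wedgeSign j K * wedgeSign k (K.erase j) + wedgeSign k K * wedgeSign j (insert k K) = 0 := by
  have h1 : wedgeSign k K = (if j < k then -1 else 1) * wedgeSign k (K.erase j) := by
    conv_lhs => rw [← Finset.insert_erase hj]
    exact wedgeSign_insert (by simp)
  have hjk : j ≠ k := fun h => hk (h ▸ hj)
  rw [h1, wedgeSign_insert hk]
  rcases lt_or_gt_of_ne hjk with h | h
  · rw [if_pos h, if_neg h.not_gt]; ring
  · rw [if_neg h.not_gt, if_pos h]; ring

/-- The Koszul homotopy formula. -/
lemma wedge_contract_add_contract_wedge (ζ : Fin n → ℂ) (a : Finset (Fin n) → ℂ)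
    (K : Finset (Fin n)) :
    wedgeCoeff ζ (contractCoeff ζ a) K + contractCoeff ζ (wedgeCoeff ζ a) K
      = (∑ j, ζ j * (starRingEnd ℂ) (ζ j)) * a K := by
  have h1 : wedgeCoeff ζ (contractCoeff ζ a) K = (∑ j ∈ K, ζ j * (starRingEnd ℂ) (ζ j)) * a K
      + ∑ j ∈ K, ∑ k ∈ Kᶜ, wedgeSign j K * wedgeSign k (K.erase j) *
        (ζ j * (starRingEnd ℂ) (ζ k) * a (insert k (K.erase j))) := by
    unfold wedgeCoeff contractCoeff
    rw [Finset.sum_mul, ← Finset.sum_add_distrib]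
    refine Finset.sum_congr rfl fun j hj => ?_
    -- The index k = j, which puts back the entry just removed, is split off as the diagonal term.
    rw [Finset.compl_erase, Finset.sum_insert (by simp [hj]), Finset.insert_erase hj, mul_add,
      Finset.mul_sum]
    congr 1
    · have : wedgeSign j (K.erase j) = wedgeSign j K := by
        conv_rhs => rw [← Finset.insert_erase hj, wedgeSign_insert_self]
      rw [this]
      linear_combination (ζ j * (starRingEnd ℂ) (ζ j) * a K) * wedgeSign_mul_self j K
    · exact Finset.sum_congr rfl fun k _ => by ring
  have h2 : contractCoeff ζ (wedgeCoeff ζ a) K = (∑ k ∈ Kᶜ, ζ k * (starRingEnd ℂ) (ζ k)) * a K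
      + ∑ k ∈ Kᶜ, ∑ j ∈ K, wedgeSign k K * wedgeSign j (insert k K) *
        (ζ j * (starRingEnd ℂ) (ζ k) * a (insert k (K.erase j))) := by
    unfold wedgeCoeff contractCoeff
    rw [Finset.sum_mul, ← Finset.sum_add_distrib]
    refine Finset.sum_congr rfl fun k hk => ?_
    rw [Finset.mem_compl] at hk
    beta_reduce
    rw [Finset.sum_insert hk, wedgeSign_insert_self, Finset.erase_insert hk, mul_add,
      Finset.mul_sum]
    congr 1
    · linear_combination (ζ k * (starRingEnd ℂ) (ζ k) * a K) * wedgeSign_mul_self k K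
    · refine Finset.sum_congr rfl fun j hj => ?_
      rw [Finset.erase_insert_of_ne (ne_of_mem_of_not_mem hj hk).symm]
      ring
  rw [h1, h2, Finset.sum_comm (s := Kᶜ), ← Finset.sum_add_sum_compl K, add_mul,
    add_add_add_comm, ← Finset.sum_add_distrib]
  rw [add_eq_left]
  refine Finset.sum_eq_zero fun j hj => ?_
  rw [← Finset.sum_add_distrib]
  refine Finset.sum_eq_zero fun k hk => ?_
  rw [← add_mul, wedgeSign_anticomm hj (Finset.mem_compl.1 hk), zero_mul]

/-- Adjointness: pairs (I, k) with k ∉ I correspond to pairs (K, k) with k ∈ K through K = I ∪ {k},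
and the signs agree because k is not counted below itself. -/
lemma sum_contract_mul_conj (ζ : Fin n → ℂ) (a b : Finset (Fin n) → ℂ) :
    ∑ I, contractCoeff ζ a I * (starRingEnd ℂ) (b I)
      = ∑ K, a K * (starRingEnd ℂ) (wedgeCoeff ζ b K) := by
  unfold contractCoeff wedgeCoeff
  simp only [map_sum, Finset.mul_sum, Finset.sum_mul]
  rw [Finset.sum_sigma', Finset.sum_sigma']
  refine Finset.sum_bij' (fun p _ => ⟨insert p.2 p.1, p.2⟩) (fun p _ => ⟨p.1.erase p.2, p.2⟩)
    ?_ ?_ ?_ ?_ ?_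
  · simp
  · simp
  · rintro ⟨I, k⟩ h
    simp only [Finset.mem_sigma, Finset.mem_univ, Finset.mem_compl, true_and] at h
    simp [Finset.erase_insert h]
  · rintro ⟨I, k⟩ h
    simp only [Finset.mem_sigma, Finset.mem_univ, true_and] at h
    simp [Finset.insert_erase h]
  · rintro ⟨I, k⟩ h
    simp only [Finset.mem_sigma, Finset.mem_univ, Finset.mem_compl, true_and] at h
    simp only [Finset.erase_insert h, map_mul, wedgeSign_insert_self, conj_wedgeSign]
    ring

lemma wedgeCoeff_const_mul (ζ : Fin n → ℂ) (a : Finset (Fin n) → ℂ) (c : ℂ)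
    (K : Finset (Fin n)) :
    wedgeCoeff ζ (fun I => c * a I) K = c * wedgeCoeff ζ a K := by
  unfold wedgeCoeff
  rw [Finset.mul_sum]
  exact Finset.sum_congr rfl fun j _ => by ring

/-- The minimal solution `b` of `ζ ∧ b = a`, when `ζ ∧ a = 0` and `ζ ≠ 0`. -/
noncomputable def minimalSolution (ζ : Fin n → ℂ) (a : Finset (Fin n) → ℂ) (I : Finset (Fin n)) :
    ℂ :=
  ((∑ j, ‖ζ j‖ ^ 2 : ℝ) : ℂ)⁻¹ * contractCoeff ζ a I

/-- In the homotopy formula the term containing ζ ∧ a drops out, leaving |ζ|² a. -/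
lemma wedgeCoeff_minimalSolution {ζ : Fin n → ℂ} {a : Finset (Fin n) → ℂ}
    (hζ : ∑ j, ‖ζ j‖ ^ 2 ≠ 0) (ha : ∀ L, wedgeCoeff ζ a L = 0) (K : Finset (Fin n)) :
    wedgeCoeff ζ (minimalSolution ζ a) K = a K := by
  have h := wedge_contract_add_contract_wedge ζ a K
  have h0 : contractCoeff ζ (wedgeCoeff ζ a) K = 0 := by
    unfold contractCoeff; simp [ha]
  have hs : ∑ j, ζ j * (starRingEnd ℂ) (ζ j) = ((∑ j, ‖ζ j‖ ^ 2 : ℝ) : ℂ) := by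
    push_cast
    exact Finset.sum_congr rfl fun j _ => Complex.mul_conj' _
  rw [h0, add_zero, hs] at h
  unfold minimalSolution
  rw [wedgeCoeff_const_mul, h, inv_mul_cancel_left₀ (by exact_mod_cast hζ)]

/-- Pair the contraction of a, which is |ζ|² times the solution b, with b itself; by adjointness
this equals the pairing of a with ζ ∧ b = a. -/
lemma sum_norm_sq_minimalSolution {ζ : Fin n → ℂ} {a : Finset (Fin n) → ℂ}
    (hζ : ∑ j, ‖ζ j‖ ^ 2 ≠ 0) (ha : ∀ L, wedgeCoeff ζ a L = 0) :
    (∑ j, ‖ζ j‖ ^ 2) * ∑ I, ‖minimalSolution ζ a I‖ ^ 2 = ∑ K, ‖a K‖ ^ 2 := by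
  have h := sum_contract_mul_conj ζ a (minimalSolution ζ a)
  simp only [wedgeCoeff_minimalSolution hζ ha, Complex.mul_conj'] at h
  have hc : ∀ I, contractCoeff ζ a I = ((∑ j, ‖ζ j‖ ^ 2 : ℝ) : ℂ) * minimalSolution ζ a I := by
    intro I
    unfold minimalSolution
    rw [mul_inv_cancel_left₀ (by exact_mod_cast hζ)]
  simp only [hc, mul_assoc, Complex.mul_conj', ← Finset.mul_sum] at h
  exact_mod_cast h

lemma minimalSolution_zero (ζ : Fin n → ℂ) {a : Finset (Fin n) → ℂ} (ha : ∀ K, a K = 0)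
    (I : Finset (Fin n)) : minimalSolution ζ a I = 0 := by
  simp [minimalSolution, contractCoeff, ha]

/-- Extension by zero of coefficients indexed by multi-indices. -/
def extendCoeff {q : ℕ} (a : MultiIndex n q → ℂ) (K : Finset (Fin n)) : ℂ :=
  if h : K.card = q then a ⟨K, h⟩ else 0

lemma extendCoeff_coe {q : ℕ} (a : MultiIndex n q → ℂ) (K : MultiIndex n q) :
    extendCoeff a K.1 = a K := by
  simp [extendCoeff, K.2]

lemma sum_norm_sq_extendCoeff {q : ℕ} (a : MultiIndex n q → ℂ) :
    ∑ K, ‖extendCoeff a K‖ ^ 2 = ∑ K, ‖a K‖ ^ 2 := by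
  rw [← Finset.sum_subset (Finset.subset_univ (Finset.univ.filter fun K => K.card = q))]
  · rw [Finset.sum_subtype (p := fun K : Finset (Fin n) => K.card = q)
      (F := inferInstanceAs (Fintype (MultiIndex n q))) _ (by simp)]
    simp [extendCoeff_coe]
  · intro K _ hK
    simp only [Finset.mem_filter, Finset.mem_univ, true_and] at hK
    simp [extendCoeff, hK]

lemma wedgeCoeff_extendCoeff {q : ℕ} (ζ : Fin n → ℂ) (a : MultiIndex n q → ℂ)
    (K : MultiIndex n (q + 1)) :
    wedgeCoeff ζ (extendCoeff a) K.1
      = ∑ j : K.1, wedgeSign j.1 K.1 * ζ j.1 * a (K.erase j) := by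
  unfold wedgeCoeff
  rw [← Finset.sum_coe_sort]
  exact Finset.sum_congr rfl fun j _ => by rw [← extendCoeff_coe a (K.erase j)]; rfl

lemma wedgeCoeff_extendCoeff_eq_zero {q : ℕ} {ζ : Fin n → ℂ} {a : MultiIndex n q → ℂ}
    (h : ∀ K : MultiIndex n (q + 1), wedgeCoeff ζ (extendCoeff a) K.1 = 0)
    (K : Finset (Fin n)) : wedgeCoeff ζ (extendCoeff a) K = 0 := by
  by_cases hK : K.card = q + 1
  · exact h ⟨K, hK⟩
  · refine Finset.sum_eq_zero fun j hj => ?_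
    have hpos := Finset.card_pos.2 ⟨j, hj⟩
    have : (K.erase j).card ≠ q := by
      rw [Finset.card_erase_of_mem hj]
      omega
    simp [extendCoeff, this]

/-- Contraction lowers the degree by exactly one, so restricting to degree q loses nothing. -/
lemma minimalSolution_extendCoeff {q : ℕ} (ζ : Fin n → ℂ) (a : MultiIndex n (q + 1) → ℂ) :
    extendCoeff (fun I : MultiIndex n q => minimalSolution ζ (extendCoeff a) I.1)
      = minimalSolution ζ (extendCoeff a) := by
  ext I
  by_cases hI : I.card = q
  · simp [extendCoeff, hI]
  · have : contractCoeff ζ (extendCoeff a) I = 0 := by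
      refine Finset.sum_eq_zero fun k hk => ?_
      have : (insert k I).card ≠ q + 1 := by
        rw [Finset.card_insert_of_notMem (Finset.mem_compl.1 hk)]
        omega
      simp [extendCoeff, this]
    unfold minimalSolution
    simp [extendCoeff, hI, this]

end ExteriorAlgebra

/-! ### The operator `∂̄` on the Fourier side. -/

section Dbar

variable {n : ℕ}

/-- The two real symbols combine as Re x_j + i Im x_j = x_j. The minus sign belongs to the test
function; transposition restores +πi x_j as the symbol of `∂̄`. -/
lemma dzbar_fourier (j : Fin n) (h : 𝓢(Cn n, ℂ)) :
    ∃ G : 𝓢(Cn n, ℂ), (∀ z, dzbar j (𝓕 h : 𝓢(Cn n, ℂ)) z = 𝓕 G z) ∧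
      ∀ x, G x = -(Real.pi * Complex.I * x j) * h x := by
  obtain ⟨G₁, h₁, e₁⟩ := lineDeriv_fourier_symbol (EuclideanSpace.single j (1 : ℂ)) h
  obtain ⟨G₂, h₂, e₂⟩ := lineDeriv_fourier_symbol (EuclideanSpace.single j Complex.I) h
  refine ⟨(1 / 2 : ℂ) • (G₁ + Complex.I • G₂), fun z => ?_, fun x => ?_⟩
  · have k₁ := congr($h₁ z)
    have k₂ := congr($h₂ z)
    rw [SchwartzMap.lineDerivOp_apply_eq_fderiv] at k₁ k₂
    rw [dzbar, k₁, k₂]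
    simp only [FourierTransform.fourier_smul, FourierTransform.fourier_add, smul_apply, add_apply,
      smul_eq_mul]
  · have i₁ : (inner ℝ x (EuclideanSpace.single j (1 : ℂ)) : ℝ) = (x j).re := by
      rw [PiLp.inner_apply, Finset.sum_eq_single j]
      · simp
      · intro k _ hk; simp [hk]
      · simp
    have i₂ : (inner ℝ x (EuclideanSpace.single j Complex.I) : ℝ) = (x j).im := by
      rw [PiLp.inner_apply, Finset.sum_eq_single j]
      · simp
      · intro k _ hk; simp [hk]
      · simp
    simp only [smul_apply, add_apply, smul_eq_mul, e₁, e₂, i₁, i₂]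
    linear_combination (-(Real.pi * Complex.I) * h x) * Complex.re_add_im (x j)

/-- The Fourier transform of a square integrable function. -/
noncomputable def fourierL2 {f : Cn n → ℂ} (hf : MemLp f 2 volume) : Lp (α := Cn n) ℂ 2 volume :=
  𝓕 (hf.toLp f : Lp (α := Cn n) ℂ 2 volume)

lemma integral_mul_fourierL2 {f : Cn n → ℂ} (hf : MemLp f 2 volume) (h : 𝓢(Cn n, ℂ)) :
    ∫ x, f x * 𝓕 h x = ∫ x, h x * fourierL2 hf x := by
  refine Eq.trans (integral_congr_ae ?_) (integral_mul_fourier_eq (hf.toLp f) h).symm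
  filter_upwards [hf.coeFn_toLp] with x hx
  rw [hx, mul_comm]

lemma memLp_coord_mul (j : Fin n) (h : 𝓢(Cn n, ℂ)) :
    MemLp (fun x => x j * h x) 2 volume := by
  refine (memLp_norm_mul h).mono
    (Continuous.aestronglyMeasurable (by fun_prop))
    (.of_forall fun x => ?_)
  rw [norm_mul, norm_mul, Complex.norm_real, norm_norm]
  exact mul_le_mul_of_nonneg_right (PiLp.norm_apply_le x j) (norm_nonneg _)

lemma integral_mul_dzbar_fourier {f : Cn n → ℂ} (hf : MemLp f 2 volume) (j : Fin n)
    (h : 𝓢(Cn n, ℂ)) :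
    ∫ z, f z * dzbar j (𝓕 h : 𝓢(Cn n, ℂ)) z
      = -(Real.pi * Complex.I) * ∫ x, x j * h x * fourierL2 hf x := by
  obtain ⟨G, hG, e⟩ := dzbar_fourier j h
  simp only [hG]
  rw [integral_mul_fourierL2 hf, ← integral_const_mul]
  congr 1 with x
  rw [e]; ring

lemma integrable_coord_mul_fourierL2 {f : Cn n → ℂ} (hf : MemLp f 2 volume) (j : Fin n)
    (h : 𝓢(Cn n, ℂ)) : Integrable (fun x => x j * h x * fourierL2 hf x) :=
  (memLp_coord_mul j h).integrable_mul (Lp.memLp (fourierL2 hf))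

lemma integral_mul_dzbar_eq {f φ : Cn n → ℂ} (j : Fin n)
    (h₁ : ∀ w, Integrable (fun z => f z * fderiv ℝ φ z w)) :
    ∫ z, f z * dzbar j φ z = (1 / 2 : ℂ) *
      ((∫ z, f z * fderiv ℝ φ z (EuclideanSpace.single j 1))
        + Complex.I * ∫ z, f z * fderiv ℝ φ z (EuclideanSpace.single j Complex.I)) := by
  rw [← integral_const_mul, ← integral_add (h₁ _) ((h₁ _).const_mul _), ← integral_const_mul]
  congr 1 with z
  rw [dzbar]; ring

/-- A square integrable `∂̄`-closed form annihilates the adjoint of `∂̄` on Schwartz functions. -/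
lemma IsDbarClosed.sum_integral_schwartz {q : ℕ} {v : AntiForm n q} (hc : IsDbarClosed v)
    (hv : ∀ J, MemLp (v J) 2 volume) (L : MultiIndex n (q + 1)) (ψ : 𝓢(Cn n, ℂ)) :
    ∑ j : L.1, wedgeSign j.1 L.1 * ∫ z, v (L.erase j) z * dzbar j.1 ψ z = 0 := by
  obtain ⟨φ, hφ, hlim⟩ := exists_testFunction_tendsto ψ
  have hz : ∀ k, ∑ j : L.1, wedgeSign j.1 L.1 * ∫ z, v (L.erase j) z * dzbar j.1 (φ k) z = 0 := by
    intro k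
    have := hc.2.2 L (φ k) (hφ k).1 (hφ k).2
    simpa using this
  have ht : Filter.Tendsto
      (fun k => ∑ j : L.1, wedgeSign j.1 L.1 * ∫ z, v (L.erase j) z * dzbar j.1 (φ k) z)
      Filter.atTop
      (nhds (∑ j : L.1, wedgeSign j.1 L.1 * ∫ z, v (L.erase j) z * dzbar j.1 ψ z)) := by
    refine tendsto_finsetSum _ fun j _ => Filter.Tendsto.const_mul _ ?_
    have := fun w => hlim (v (L.erase j)) w (hv _)
    rw [integral_mul_dzbar_eq _ fun w => (this w).1]
    simp only [fun k => integral_mul_dzbar_eq (f := v (L.erase j)) (φ := φ k) j.1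
      fun w => (this w).2.1 k]
    exact ((this _).2.2.add ((this _).2.2.const_mul _)).const_mul _
  simp only [hz] at ht
  exact tendsto_nhds_unique ht tendsto_const_nhds

/-- `∂̄ v = 0` on the Fourier side. -/
lemma IsDbarClosed.fourier {q : ℕ} {v : AntiForm n q} (hc : IsDbarClosed v)
    (hv : ∀ J, MemLp (v J) 2 volume) (L : MultiIndex n (q + 1)) :
    ∀ᵐ x : Cn n, ∑ j : L.1, wedgeSign j.1 L.1 * (Real.pi * Complex.I * x j.1)
      * fourierL2 (hv (L.erase j)) x = 0 := by
  refine ae_eq_zero_of_integral_contDiff_smul_eq_zero ?_ ?_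
  · refine locallyIntegrable_finsetSum _ fun j _ => ?_
    have := ((Lp.memLp (fourierL2 (hv (L.erase j)))).locallyIntegrable
      (by norm_num)).locallyIntegrableOn Set.univ
    rw [← locallyIntegrableOn_univ]
    exact this.continuousOn_mul
      (g := fun x : Cn n => wedgeSign j.1 L.1 * (Real.pi * Complex.I * x j.1))
      (by fun_prop) isOpen_univ.isLocallyClosed
  · intro g hg hgc
    have hg₁ : HasCompactSupport (Complex.ofRealCLM ∘ g) := hgc.comp_left rfl
    have hg₂ : ContDiff ℝ (⊤ : ℕ∞) (Complex.ofRealCLM ∘ g) := by fun_prop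
    set h : 𝓢(Cn n, ℂ) := hg₁.toSchwartzMap hg₂
    have hhx : ∀ x, h x = (g x : ℂ) := fun x => rfl
    -- `𝓕 h` is only known to be a Schwartz function, so the definition of closedness does not apply
    -- to it directly; the extension to Schwartz functions does.
    have key := hc.sum_integral_schwartz hv L (𝓕 h)
    simp only [fun j : L.1 => integral_mul_dzbar_fourier (hv (L.erase j)) j.1 h] at key
    have e : ∀ x : Cn n, g x • ∑ j : L.1, wedgeSign j.1 L.1 * (Real.pi * Complex.I * x j.1)
        * fourierL2 (hv (L.erase j)) x = ∑ j : L.1, wedgeSign j.1 L.1 * (Real.pi * Complex.I) *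
          (x j.1 * h x * fourierL2 (hv (L.erase j)) x) := by
      intro x
      rw [Complex.real_smul, Finset.mul_sum]
      refine Finset.sum_congr rfl fun j _ => ?_
      rw [hhx]; ring
    simp only [e]
    rw [integral_finsetSum _ fun (j : L.1) _ =>
      (integrable_coord_mul_fourierL2 (hv (L.erase j)) j.1 h).const_mul _]
    simp only [integral_const_mul]
    rw [← neg_eq_zero, ← key, ← Finset.sum_neg_distrib]
    exact Finset.sum_congr rfl fun j _ => by ring

/-- An equation `∂̄ u = v` between square integrable forms can be checked on the Fourier side. -/
lemma isDbar_of_fourier {q : ℕ} {u : AntiForm n q} {v : AntiForm n (q + 1)} (hu : ∀ J, MemLp (u J) 2 volume)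
    (hv : ∀ K, MemLp (v K) 2 volume)
    (h : ∀ K : MultiIndex n (q + 1), ∀ᵐ x : Cn n, ∑ j : K.1, wedgeSign j.1 K.1 *
      (Real.pi * Complex.I * x j.1) * fourierL2 (hu (K.erase j)) x = fourierL2 (hv K) x) :
    IsDbar u v := by
  refine ⟨fun J => (hu J).locallyIntegrable (by norm_num),
    fun K => (hv K).locallyIntegrable (by norm_num), fun K φ hφ hφc => ?_⟩
  -- Fourier inversion writes the test function as a transform, so both sides of the equation can be
  -- moved to the Fourier side.
  obtain ⟨ψ, hψ⟩ : ∃ ψ : 𝓢(Cn n, ℂ), φ = 𝓕 ψ := by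
    refine ⟨𝓕⁻ (hφc.toSchwartzMap hφ), ?_⟩
    have : 𝓕 (𝓕⁻ (hφc.toSchwartzMap hφ)) = hφc.toSchwartzMap hφ :=
      FourierTransform.fourier_fourierInv_eq _
    rw [this]
    rfl
  have e1 : ∫ z, v K z * φ z = ∫ x, ψ x * fourierL2 (hv K) x := by
    rw [hψ]
    exact integral_mul_fourierL2 (hv K) ψ
  have e2 : ∀ j : K.1, ∫ z, u (K.erase j) z * dzbar j.1 φ z
      = -(Real.pi * Complex.I) * ∫ x, x j.1 * ψ x * fourierL2 (hu (K.erase j)) x := by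
    intro j
    rw [hψ]
    exact integral_mul_dzbar_fourier (hu (K.erase j)) j.1 ψ
  have e3 : ∫ x, ψ x * fourierL2 (hv K) x = ∫ x, ∑ j : K.1, wedgeSign j.1 K.1 *
      (Real.pi * Complex.I) * (x j.1 * ψ x * fourierL2 (hu (K.erase j)) x) := by
    refine integral_congr_ae ?_
    filter_upwards [h K] with x hx
    rw [← hx, Finset.mul_sum]
    exact Finset.sum_congr rfl fun j _ => by ring
  rw [e1, e3, integral_finsetSum _ fun (j : K.1) _ =>
    (integrable_coord_mul_fourierL2 (hu (K.erase j)) j.1 ψ).const_mul _]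
  simp only [integral_const_mul, e2]
  rw [← Finset.sum_neg_distrib]
  exact Finset.sum_congr rfl fun j _ => by ring

lemma integral_norm_sq_fourierL2 {f : Cn n → ℂ} (hf : MemLp f 2 volume) :
    ∫ x, ‖fourierL2 hf x‖ ^ 2 = ∫ z, ‖f z‖ ^ 2 := by
  rw [← norm_sq_toLp hf, ← norm_sq_toLp (Lp.memLp (fourierL2 hf)), Lp.toLp_coeFn, fourierL2,
    Lp.norm_fourier_eq]

lemma exists_fourierL2_eq {F : Cn n → ℂ} (hF : MemLp F 2 volume) :
    ∃ (f : Cn n → ℂ) (hf : MemLp f 2 volume), fourierL2 hf =ᵐ[volume] F := by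
  let g : Lp (α := Cn n) ℂ 2 volume := 𝓕⁻ (hF.toLp F : Lp (α := Cn n) ℂ 2 volume)
  refine ⟨g, Lp.memLp g, ?_⟩
  have : fourierL2 (Lp.memLp g) = hF.toLp F := by
    rw [fourierL2, Lp.toLp_coeFn]
    exact FourierTransform.fourier_fourierInv_eq _
  rw [this]
  exact hF.coeFn_toLp

/-- The symbol of `∂̄`. -/
noncomputable def dbarSymbol (x : Cn n) (j : Fin n) : ℂ := Real.pi * Complex.I * x j

lemma sum_norm_sq_dbarSymbol (x : Cn n) :
    ∑ j, ‖dbarSymbol x j‖ ^ 2 = Real.pi ^ 2 * ‖x‖ ^ 2 := by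
  simp [dbarSymbol, EuclideanSpace.norm_sq_eq, mul_pow, Finset.mul_sum]

/-- The minimal solution of `∂̄ u = v` for an `L²` closed form whose Fourier transform is divisible
by `‖ξ‖` in `L²`. -/
theorem exists_isDbar_of_fourier_eq {q : ℕ} {v : AntiForm n (q + 1)} (hc : IsDbarClosed v)
    (hv : ∀ K, MemLp (v K) 2 volume) {F : MultiIndex n (q + 1) → Cn n → ℂ} (hF : ∀ K, MemLp (F K) 2 volume)
    (hvF : ∀ K, ∀ᵐ x, fourierL2 (hv K) x = ‖x‖ * F K x) :
    ∃ u : AntiForm n q, u.IsL2 ∧ IsDbar u v ∧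
      ∫ z, u.normSq z ≤ (Real.pi ^ 2)⁻¹ * ∑ K, ∫ x, ‖F K x‖ ^ 2 := by
  let a : Cn n → Finset (Fin n) → ℂ := fun x => extendCoeff fun K => fourierL2 (hv K) x
  let b : MultiIndex n q → Cn n → ℂ := fun I x => minimalSolution (dbarSymbol x) (a x) I.1
  have hclosed : ∀ᵐ x, ∀ L, wedgeCoeff (dbarSymbol x) (a x) L = 0 := by
    filter_upwards [ae_all_iff.2 fun L => hc.fourier hv L] with x hx
    refine wedgeCoeff_extendCoeff_eq_zero fun L => ?_
    rw [wedgeCoeff_extendCoeff]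
    exact hx L
  have haF : ∀ᵐ x, ∀ K, fourierL2 (hv K) x = ‖x‖ * F K x := ae_all_iff.2 hvF
  have hsolve : ∀ᵐ x, ∀ K : MultiIndex n (q + 1),
      ∑ j : K.1, wedgeSign j.1 K.1 * dbarSymbol x j.1 * b (K.erase j) x
        = fourierL2 (hv K) x := by
    filter_upwards [hclosed, haF] with x hx hxF K
    rw [← wedgeCoeff_extendCoeff (dbarSymbol x) (fun I => b I x), minimalSolution_extendCoeff]
    -- The origin is not discarded as a null set: v̂ = ‖x‖F forces v̂ to vanish there, and the
    -- minimal solution vanishes with it.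
    by_cases h0 : x = 0
    · have hx0 : ∀ K, fourierL2 (hv K) x = 0 := fun K => by rw [hxF]; simp [h0]
      have ha : ∀ K, a x K = 0 := fun K => by simp [a, extendCoeff, hx0]
      rw [← extendCoeff_coe (fun K => fourierL2 (hv K) x) K]
      change _ = a x K.1
      rw [ha]
      exact Finset.sum_eq_zero fun j _ => by
        rw [minimalSolution_zero _ ha, mul_zero]
    · rw [wedgeCoeff_minimalSolution _ hx]
      · exact extendCoeff_coe (fun K => fourierL2 (hv K) x) K
      rw [sum_norm_sq_dbarSymbol]
      have := norm_pos_iff.2 h0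
      positivity
  have hnorm : ∀ᵐ x, ∑ I, ‖b I x‖ ^ 2 ≤ (Real.pi ^ 2)⁻¹ * ∑ K, ‖F K x‖ ^ 2 := by
    filter_upwards [hclosed, haF] with x hx hxF
    have e : ∑ I, ‖b I x‖ ^ 2 = ∑ I, ‖minimalSolution (dbarSymbol x) (a x) I‖ ^ 2 := by
      rw [← sum_norm_sq_extendCoeff (fun I => b I x), minimalSolution_extendCoeff]
    rw [e]
    by_cases h0 : x = 0
    · have hx0 : ∀ K, fourierL2 (hv K) x = 0 := fun K => by rw [hxF]; simp [h0]
      have ha : ∀ K, a x K = 0 := fun K => by simp [a, extendCoeff, hx0]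
      simp only [minimalSolution_zero _ ha, norm_zero]
      simp only [ne_eq, OfNat.ofNat_ne_zero, not_false_eq_true, zero_pow, Finset.sum_const_zero]
      positivity
    · have hpos := norm_pos_iff.2 h0
      have h1 := sum_norm_sq_minimalSolution (ζ := dbarSymbol x)
        (by rw [sum_norm_sq_dbarSymbol]; positivity) hx
      rw [sum_norm_sq_dbarSymbol, sum_norm_sq_extendCoeff] at h1
      simp only [hxF, norm_mul, Complex.norm_real, norm_norm, mul_pow, ← Finset.mul_sum] at h1
      rw [inv_mul_eq_div, le_div_iff₀ (by positivity)]
      -- The factor ‖x‖² of |ζ|² cancels the one in |v̂|² = ‖x‖²|F|²; only π² remains.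
      refine le_of_mul_le_mul_left (a := ‖x‖ ^ 2) ?_ (by positivity)
      linarith
  have hbm : ∀ I, AEStronglyMeasurable (b I) volume := by
    intro I
    have hζ : ∀ j, Measurable fun x : Cn n => dbarSymbol x j := fun j => by
      unfold dbarSymbol; fun_prop
    have ha : ∀ K, AEMeasurable (fun x => a x K) volume := by
      intro K
      by_cases hK : K.card = q + 1
      · simpa [a, extendCoeff, hK] using (Lp.memLp (fourierL2 (hv ⟨K, hK⟩))).1.aemeasurable
      · simp [a, extendCoeff, hK]
    refine AEMeasurable.aestronglyMeasurable ?_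
    refine AEMeasurable.mul ?_ ?_
    · exact (Complex.measurable_ofReal.comp (Finset.measurable_fun_sum _ fun j _ =>
        (hζ j).norm.pow_const 2)).inv.aemeasurable
    · exact Finset.aemeasurable_fun_sum _ fun k _ =>
        ((Complex.continuous_conj.measurable.comp (hζ k)).const_mul _).aemeasurable.mul (ha _)
  have hFi : ∀ K, Integrable (fun x => ‖F K x‖ ^ 2) := fun K =>
    (hF K).integrable_norm_pow two_ne_zero
  have hFs : Integrable fun x => (Real.pi ^ 2)⁻¹ * ∑ K, ‖F K x‖ ^ 2 :=
    (integrable_finsetSum _ fun K _ => hFi K).const_mul _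
  have hb2 : ∀ I, MemLp (b I) 2 volume := by
    intro I
    rw [memLp_two_iff_integrable_sq_norm (hbm I)]
    refine hFs.mono' ((hbm I).norm.pow 2) ?_
    filter_upwards [hnorm] with x hx
    rw [norm_pow, norm_norm]
    exact (Finset.single_le_sum (f := fun I => ‖b I x‖ ^ 2) (fun _ _ => sq_nonneg _)
      (Finset.mem_univ I)).trans hx
  choose u hu hub using fun I => exists_fourierL2_eq (hb2 I)
  refine ⟨u, hu, isDbar_of_fourier hu hv fun K => ?_, ?_⟩
  · filter_upwards [hsolve, ae_all_iff.2 hub] with x hx hxu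
    rw [← hx K]
    refine Finset.sum_congr rfl fun j _ => ?_
    rw [hxu]; rfl
  · have hui : ∀ I, Integrable (fun z => ‖u I z‖ ^ 2) := fun I =>
      (hu I).integrable_norm_pow two_ne_zero
    have hbi : ∀ I, Integrable (fun z => ‖b I z‖ ^ 2) := fun I =>
      (hb2 I).integrable_norm_pow two_ne_zero
    calc ∫ z, AntiForm.normSq u z = ∑ I, ∫ z, ‖u I z‖ ^ 2 :=
          integral_finsetSum _ fun I _ => hui I
      _ = ∑ I, ∫ x, ‖b I x‖ ^ 2 := by
          refine Finset.sum_congr rfl fun I _ => ?_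
          rw [← integral_norm_sq_fourierL2 (hu I)]
          refine integral_congr_ae ?_
          filter_upwards [hub I] with x hx
          rw [hx]
      _ = ∫ x, ∑ I, ‖b I x‖ ^ 2 := (integral_finsetSum _ fun I _ => hbi I).symm
      _ ≤ ∫ x, (Real.pi ^ 2)⁻¹ * ∑ K, ‖F K x‖ ^ 2 :=
          integral_mono_ae (integrable_finsetSum _ fun I _ => hbi I) hFs hnorm
      _ = _ := by rw [integral_const_mul, integral_finsetSum _ fun K _ => hFi K]

end Dbar

/-! ### Distance to the subspace, and conclusion. -/

/-- The distance to a nonempty affine subspace in terms of an orthonormal basis of the orthogonal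
complement of its direction. -/
lemma infDist_sq_eq_sqDist {V : Type*} [NormedAddCommGroup V] [InnerProductSpace ℝ V]
    [FiniteDimensional ℝ V] (H : AffineSubspace ℝ V) {a : V} (ha : a ∈ H) {ι : Type*} [Fintype ι]
    (b : OrthonormalBasis ι ℝ H.directionᗮ) (z : V) :
    Metric.infDist z (H : Set V) ^ 2 = sqDist (fun i => (b i : V)) a z := by
  have : Nonempty H := ⟨⟨a, ha⟩⟩
  rw [← EuclideanGeometry.dist_orthogonalProjection_eq_infDist]
  set p : V := (EuclideanGeometry.orthogonalProjection H z).1 with hp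
  have hzp : z - p ∈ H.directionᗮ := by
    simpa [hp] using EuclideanGeometry.vsub_orthogonalProjection_mem_direction_orthogonal H z
  have hpa : p - a ∈ H.direction := by
    have := AffineSubspace.vsub_mem_direction
      (EuclideanGeometry.orthogonalProjection_mem (s := H) z) ha
    simpa [hp] using this
  have h := b.sum_sq_norm_inner_right ⟨z - p, hzp⟩
  rw [dist_eq_norm, sqDist]
  have e : ‖z - p‖ = ‖(⟨z - p, hzp⟩ : H.directionᗮ)‖ := rfl
  rw [e, ← h]
  refine Finset.sum_congr rfl fun i _ => ?_
  rw [Real.norm_eq_abs, sq_abs, Submodule.coe_inner]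
  congr 1
  -- The base point `a` may replace the foot `p` of the perpendicular, as they differ by a
  -- tangential vector.
  have h0 : inner ℝ (b i : V) (p - a) = 0 := Submodule.inner_left_of_mem_orthogonal hpa (b i).2
  rw [← sub_add_sub_cancel z p a, inner_add_right, h0, add_zero]

/-- The degree of `v` is `q + 1`, which encodes degree at least one; n ≥ 1 is automatic, since
codimension at least 3 forces 2n ≥ 3. -/
theorem corollary2p3 (n m q : ℕ) (H : AffineSubspace ℝ (Cn n)) (hne : (H : Set (Cn n)).Nonempty)
    (hcodim : Module.finrank ℝ (Cn n ⧸ H.direction) = m) (hm : 3 ≤ m)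
    (v : AntiForm n (q + 1)) (hclosed : IsDbarClosed v) (hv : v.IsL2)
    (hvH : Integrable (fun z => v.normSq z * Metric.infDist z (H : Set (Cn n)) ^ 2) volume) :
    ∃ u : AntiForm n q, u.IsL2 ∧ IsDbar u v ∧
      ∫ z, u.normSq z ≤
        16 / ((m : ℝ) - 2) ^ 2 *
          ∫ z, v.normSq z * Metric.infDist z (H : Set (Cn n)) ^ 2 := by
  obtain ⟨a, ha⟩ := hne
  let b := stdOrthonormalBasis ℝ H.directionᗮ
  have hcard : Fintype.card (Fin (Module.finrank ℝ H.directionᗮ)) = m := by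
    have h1 := Submodule.finrank_add_finrank_orthogonal H.direction
    have h2 := Submodule.finrank_quotient_add_finrank H.direction
    rw [Fintype.card_fin]
    omega
  have he : Orthonormal ℝ fun i => (b i : Cn n) :=
    b.orthonormal.comp_linearIsometry H.directionᗮ.subtypeₗᵢ
  have hd := fun z => infDist_sq_eq_sqDist H ha b z
  simp only [hd] at hvH ⊢
  have hvd : ∀ K, Integrable (fun z => ‖v K z‖ ^ 2 * sqDist (fun i => (b i : Cn n)) a z) := by
    intro K
    refine hvH.mono' (((hv K).1.norm.pow 2).mul
      (continuous_sqDist _ a).aestronglyMeasurable) (.of_forall fun z => ?_)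
    rw [Real.norm_of_nonneg (mul_nonneg (sq_nonneg _) (sqDist_nonneg _ a z))]
    exact mul_le_mul_of_nonneg_right (Finset.single_le_sum (f := fun K => ‖v K z‖ ^ 2)
      (fun _ _ => sq_nonneg _) (Finset.mem_univ K)) (sqDist_nonneg _ a z)
  choose F hF hFn hvF using fun K =>
    exists_fourier_eq_norm_mul he a (by rw [hcard]; exact hm) (hv K) (hvd K)
  obtain ⟨u, hu, huv, hun⟩ := exists_isDbar_of_fourier_eq hclosed hv hF hvF
  refine ⟨u, hu, huv, hun.trans ?_⟩
  rw [hcard] at hFn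
  calc (Real.pi ^ 2)⁻¹ * ∑ K, ∫ x, ‖F K x‖ ^ 2
      ≤ (Real.pi ^ 2)⁻¹ * ∑ K, 16 * Real.pi ^ 2 / ((m : ℝ) - 2) ^ 2 *
        ∫ z, ‖v K z‖ ^ 2 * sqDist (fun i => (b i : Cn n)) a z := by
        gcongr with K
        exact hFn K
    _ = 16 / ((m : ℝ) - 2) ^ 2 *
        ∑ K, ∫ z, ‖v K z‖ ^ 2 * sqDist (fun i => (b i : Cn n)) a z := by
        rw [← Finset.mul_sum]
        field_simp
    _ = _ := by
        rw [← integral_finsetSum _ fun K _ => hvd K]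
        simp only [AntiForm.normSq, Finset.sum_mul]
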